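/- Formulae are generated from propositional atoms by $\neg,\lor,\Box$. Labels come from a countably infinite set. A sequent $\mathcal T,\Gamma\vdash\Delta$ consists of a finite set $\mathcal T$ of relational atoms $xRy$ and finite multisets $\Gamma,\Delta$ of labeled formulae $x:\phi$. It is a tree sequent if $\mathcal T$, read as a directed graph, is a rooted tree with edges directed away from the root (or is empty), every label of $\Gamma,\Delta$ occurs in $\mathcal T$ when $\mathcal T\neq\emptyset$, and exactly one label occurs in $\Gamma,\Delta$ when $\mathcal T=\emptyset$. A leaf is a label of the sequent without children (so the only label of a sequent with $\mathcal T=\emptyset$ is a leaf); a pre-leaf is a label all of whose children are leaves. A $\mathsf{CSGL}$ proof is a finite tree of tree sequents built with the following rules (premises / conclusion). - Initial rules: $\mathsf{id_1}$: $\mathcal T,\Gamma,x:p\vdash x:p,\Delta$ ($p$ an atom); $\mathsf{id_2}$: $\mathcal T,\Gamma,x:\Box\phi\vdash x:\Box\phi,\Delta$. - Local rules: $\neg\mathsf L$: $\mathcal T,\Gamma\vdash x:\phi,\Delta$ / $\mathcal T,\Gamma,x:\neg\phi\vdash\Delta$; $\neg\mathsf R$: $\mathcal T,\Gamma,x:\phi\vdash\Delta$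 / $\mathcal T,\Gamma\vdash x:\neg\phi,\Delta$; $\lor\mathsf L$: $\mathcal T,\Gamma,x:\phi\vdash\Delta$ and $\mathcal T,\Gamma,x:\psi\vdash\Delta$ / $\mathcal T,\Gamma,x:\phi\lor\psi\vdash\Delta$; $\lor\mathsf R$: $\mathcal T,\Gamma\vdash x:\phi,x:\psi,\Delta$ / $\mathcal T,\Gamma\vdash x:\phi\lor\psi,\Delta$. - Propagation rules: $\Box\mathsf L$: $\mathcal T,xRy,\Gamma,x:\Box\phi,y:\phi\vdash\Delta$ / $\mathcal T,xRy,\Gamma,x:\Box\phi\vdash\Delta$; $\mathsf{4L}$: $\mathcal T,xRy,\Gamma,x:\Box\phi,y:\Box\phi\vdash\Delta$ / $\mathcal T,xRy,\Gamma,x:\Box\phi\vdash\Delta$. - $\Box\mathsf R$: $\mathcal T,xRy,\Gamma,y:\Box\phi\vdash y:\phi,\Delta$ / $\mathcal T,\Gamma\vdash x:\Box\phi,\Delta$, where $y$ is fresh, i.e. does not occur in the conclusion. In each rule $x$ is the principal label; in the propagation rules $y$ is the auxiliary label. A proof is end-active if the principal label of every instance of an initial or local rule is a leaf, and the principal and auxiliary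 labels of every instance of a propagation rule are a pre-leaf and a leaf, respectively; $\Box\mathsf R$ is unrestricted. **Theorem.** For every label $x$, every formula $\phi$ and every $\mathsf{CSGL}$ proof of $\vdash x:\phi$, there is an end-active $\mathsf{CSGL}$ proof of the same sequent $\vdash x:\phi$, and it can be chosen so that distinct instances of $\Box\mathsf R$ have distinct fresh labels. -/

import Mathlib

/-- Formulae of Goedel-Loeb provability logic over a set `α` of propositional atoms. -/
inductive Formula (α : Type*) where
  | atom (p : α) : Formula α
  | neg (φ : Formula α) : Formula α
  | or (φ ψ : Formula α) : Formula α
  | box (φ : Formula α) : Formula α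

/-- The countably infinite set of labels. -/
abbrev Label : Type := ℕ

/-- A labeled formula `x : φ` is the pair `(x, φ)`. -/
abbrev LFormula (α : Type*) : Type _ := Label × Formula α

/-- A labeled sequent `R, Γ ⊢ Δ`: a (finite) set `rel` of relational atoms, where `(x, y)` stands
for `xRy`, and two finite multisets of labeled formulae. -/
structure Sequent (α : Type*) where
  rel : Finset (Label × Label)
  ant : Multiset (LFormula α)
  suc : Multiset (LFormula α)

/-- The labels occurring in a set of relational atoms. -/
def relLabels (T : Finset (Label × Label)) : Finset Label :=
  T.image Prod.fst ∪ T.image Prod.snd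

/-- The labels occurring in a multiset of labeled formulae. -/
def formulaLabels {α : Type*} (Γ : Multiset (LFormula α)) : Finset Label :=
  (Γ.map Prod.fst).toFinset

/-- A set of relational atoms is a tree if it is a rooted tree with all edges directed away from
the root: some `r` has no parent, every vertex is reachable from `r`, and no vertex has two
parents. The empty set of relational atoms is a tree. -/
def IsTree (T : Finset (Label × Label)) : Prop :=
  ∃ r : Label, (∀ x, (x, r) ∉ T) ∧
    (∀ y ∈ relLabels T, Relation.ReflTransGen (fun a b => (a, b) ∈ T) r y) ∧
    (∀ x x' y, (x, y) ∈ T → (x', y) ∈ T → x = x')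

namespace Sequent

variable {α : Type*}

/-- All labels occurring in a sequent. -/
def labels (S : Sequent α) : Finset Label :=
  relLabels S.rel ∪ (formulaLabels S.ant ∪ formulaLabels S.suc)

/-- Tree sequents: the relational atoms form a tree; if there are any, every label of a formula
occurs in them; if there are none, the formulae all share one label (and there is one). -/
def IsTreeSequent (S : Sequent α) : Prop :=
  IsTree S.rel ∧
  (S.rel ≠ ∅ → formulaLabels S.ant ∪ formulaLabels S.suc ⊆ relLabels S.rel) ∧
  (S.rel = ∅ → (formulaLabels S.ant ∪ formulaLabels S.suc).card = 1)

/-- A leaf is a label of the sequent without children. In particular, the only label of a sequent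
without relational atoms is a leaf. -/
def IsLeaf (S : Sequent α) (x : Label) : Prop :=
  x ∈ S.labels ∧ ∀ y, (x, y) ∉ S.rel

/-- A pre-leaf is a label of the sequent all of whose children are leaves. -/
def IsPreLeaf (S : Sequent α) (x : Label) : Prop :=
  x ∈ S.labels ∧ ∀ y, (x, y) ∈ S.rel → S.IsLeaf y

/-- The sequent `⊢ x : φ`. -/
def single (x : Label) (φ : Formula α) : Sequent α := ⟨∅, 0, {(x, φ)}⟩

end Sequent

open Formula in
/-- `CSGLProof S` is the type of proofs of `S` in the labeled tree sequent calculus `CSGL`: finite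
trees built from instances of the rules below, all of whose sequents are tree sequents. -/
inductive CSGLProof {α : Type*} : Sequent α → Type _ where
  /-- `T, Γ, x : p ⊢ x : p, Δ` for an atom `p`. -/
  | id1 (T : Finset (Label × Label)) (Γ Δ : Multiset (LFormula α)) (x : Label) (p : α)
      (tree : Sequent.IsTreeSequent ⟨T, (x, atom p) ::ₘ Γ, (x, atom p) ::ₘ Δ⟩) :
      CSGLProof ⟨T, (x, atom p) ::ₘ Γ, (x, atom p) ::ₘ Δ⟩
  /-- `T, Γ, x : □φ ⊢ x : □φ, Δ`. -/
  | id2 (T : Finset (Label × Label)) (Γ Δ : Multiset (LFormula α)) (x : Label) (φ : Formula α)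
      (tree : Sequent.IsTreeSequent ⟨T, (x, box φ) ::ₘ Γ, (x, box φ) ::ₘ Δ⟩) :
      CSGLProof ⟨T, (x, box φ) ::ₘ Γ, (x, box φ) ::ₘ Δ⟩
  /-- From `T, Γ ⊢ x : φ, Δ` infer `T, Γ, x : ¬φ ⊢ Δ`. -/
  | negL (T : Finset (Label × Label)) (Γ Δ : Multiset (LFormula α)) (x : Label) (φ : Formula α)
      (tree : Sequent.IsTreeSequent ⟨T, (x, neg φ) ::ₘ Γ, Δ⟩)
      (π : CSGLProof ⟨T, Γ, (x, φ) ::ₘ Δ⟩) :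
      CSGLProof ⟨T, (x, neg φ) ::ₘ Γ, Δ⟩
  /-- From `T, Γ, x : φ ⊢ Δ` infer `T, Γ ⊢ x : ¬φ, Δ`. -/
  | negR (T : Finset (Label × Label)) (Γ Δ : Multiset (LFormula α)) (x : Label) (φ : Formula α)
      (tree : Sequent.IsTreeSequent ⟨T, Γ, (x, neg φ) ::ₘ Δ⟩)
      (π : CSGLProof ⟨T, (x, φ) ::ₘ Γ, Δ⟩) :
      CSGLProof ⟨T, Γ, (x, neg φ) ::ₘ Δ⟩
  /-- From `T, Γ, x : φ ⊢ Δ` and `T, Γ, x : ψ ⊢ Δ` infer `T, Γ, x : φ ∨ ψ ⊢ Δ`. -/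
  | orL (T : Finset (Label × Label)) (Γ Δ : Multiset (LFormula α)) (x : Label) (φ ψ : Formula α)
      (tree : Sequent.IsTreeSequent ⟨T, (x, Formula.or φ ψ) ::ₘ Γ, Δ⟩)
      (π₁ : CSGLProof ⟨T, (x, φ) ::ₘ Γ, Δ⟩) (π₂ : CSGLProof ⟨T, (x, ψ) ::ₘ Γ, Δ⟩) :
      CSGLProof ⟨T, (x, Formula.or φ ψ) ::ₘ Γ, Δ⟩
  /-- From `T, Γ ⊢ x : φ, x : ψ, Δ` infer `T, Γ ⊢ x : φ ∨ ψ, Δ`. -/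
  | orR (T : Finset (Label × Label)) (Γ Δ : Multiset (LFormula α)) (x : Label) (φ ψ : Formula α)
      (tree : Sequent.IsTreeSequent ⟨T, Γ, (x, Formula.or φ ψ) ::ₘ Δ⟩)
      (π : CSGLProof ⟨T, Γ, (x, φ) ::ₘ (x, ψ) ::ₘ Δ⟩) :
      CSGLProof ⟨T, Γ, (x, Formula.or φ ψ) ::ₘ Δ⟩
  /-- From `T, xRy, Γ, x : □φ, y : φ ⊢ Δ` infer `T, xRy, Γ, x : □φ ⊢ Δ`. -/
  | boxL (T : Finset (Label × Label)) (Γ Δ : Multiset (LFormula α)) (x y : Label) (φ : Formula α)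
      (edge : (x, y) ∈ T)
      (tree : Sequent.IsTreeSequent ⟨T, (x, box φ) ::ₘ Γ, Δ⟩)
      (π : CSGLProof ⟨T, (y, φ) ::ₘ (x, box φ) ::ₘ Γ, Δ⟩) :
      CSGLProof ⟨T, (x, box φ) ::ₘ Γ, Δ⟩
  /-- From `T, xRy, Γ, x : □φ, y : □φ ⊢ Δ` infer `T, xRy, Γ, x : □φ ⊢ Δ`. -/
  | fourL (T : Finset (Label × Label)) (Γ Δ : Multiset (LFormula α)) (x y : Label)
      (φ : Formula α) (edge : (x, y) ∈ T)
      (tree : Sequent.IsTreeSequent ⟨T, (x, box φ) ::ₘ Γ, Δ⟩)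
      (π : CSGLProof ⟨T, (y, box φ) ::ₘ (x, box φ) ::ₘ Γ, Δ⟩) :
      CSGLProof ⟨T, (x, box φ) ::ₘ Γ, Δ⟩
  /-- From `T, xRy, Γ, y : □φ ⊢ y : φ, Δ` infer `T, Γ ⊢ x : □φ, Δ`, where `y` is fresh, i.e. does
  not occur in the conclusion. -/
  | boxR (T : Finset (Label × Label)) (Γ Δ : Multiset (LFormula α)) (x y : Label) (φ : Formula α)
      (fresh : y ∉ Sequent.labels ⟨T, Γ, (x, box φ) ::ₘ Δ⟩)
      (tree : Sequent.IsTreeSequent ⟨T, Γ, (x, box φ) ::ₘ Δ⟩)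
      (π : CSGLProof ⟨insert (x, y) T, (y, box φ) ::ₘ Γ, (y, φ) ::ₘ Δ⟩) :
      CSGLProof ⟨T, Γ, (x, box φ) ::ₘ Δ⟩

namespace CSGLProof

variable {α : Type*}

/-- A proof is end-active if the principal label of every initial rule and of every local rule is a
leaf, and the principal and auxiliary label of every propagation rule are a pre-leaf and a leaf,
respectively; `boxR` is unrestricted. (The sequents in a rule instance other than `boxR` have the
same relational atoms and labels, so it does not matter in which of them this is evaluated; the
conclusion is used.) -/
def EndActive : {S : Sequent α} → CSGLProof S → Prop
  | _, id1 T Γ Δ x p _ =>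
      Sequent.IsLeaf ⟨T, (x, Formula.atom p) ::ₘ Γ, (x, Formula.atom p) ::ₘ Δ⟩ x
  | _, id2 T Γ Δ x φ _ =>
      Sequent.IsLeaf ⟨T, (x, Formula.box φ) ::ₘ Γ, (x, Formula.box φ) ::ₘ Δ⟩ x
  | _, negL T Γ Δ x φ _ π => Sequent.IsLeaf ⟨T, (x, Formula.neg φ) ::ₘ Γ, Δ⟩ x ∧ π.EndActive
  | _, negR T Γ Δ x φ _ π => Sequent.IsLeaf ⟨T, Γ, (x, Formula.neg φ) ::ₘ Δ⟩ x ∧ π.EndActive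
  | _, orL T Γ Δ x φ ψ _ π₁ π₂ =>
      Sequent.IsLeaf ⟨T, (x, Formula.or φ ψ) ::ₘ Γ, Δ⟩ x ∧ π₁.EndActive ∧ π₂.EndActive
  | _, orR T Γ Δ x φ ψ _ π =>
      Sequent.IsLeaf ⟨T, Γ, (x, Formula.or φ ψ) ::ₘ Δ⟩ x ∧ π.EndActive
  | _, boxL T Γ Δ x y φ _ _ π =>
      Sequent.IsPreLeaf ⟨T, (x, Formula.box φ) ::ₘ Γ, Δ⟩ x ∧
        Sequent.IsLeaf ⟨T, (x, Formula.box φ) ::ₘ Γ, Δ⟩ y ∧ π.EndActive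
  | _, fourL T Γ Δ x y φ _ _ π =>
      Sequent.IsPreLeaf ⟨T, (x, Formula.box φ) ::ₘ Γ, Δ⟩ x ∧
        Sequent.IsLeaf ⟨T, (x, Formula.box φ) ::ₘ Γ, Δ⟩ y ∧ π.EndActive
  | _, boxR _ _ _ _ _ _ _ _ π => π.EndActive

/-- The list of the fresh labels of all `boxR` instances in a proof, with repetitions. -/
def freshLabels : {S : Sequent α} → CSGLProof S → List Label
  | _, id1 .. => []
  | _, id2 .. => []
  | _, negL _ _ _ _ _ _ π => π.freshLabels
  | _, negR _ _ _ _ _ _ π => π.freshLabels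
  | _, orL _ _ _ _ _ _ _ π₁ π₂ => π₁.freshLabels ++ π₂.freshLabels
  | _, orR _ _ _ _ _ _ _ π => π.freshLabels
  | _, boxL _ _ _ _ _ _ _ _ π => π.freshLabels
  | _, fourL _ _ _ _ _ _ _ _ π => π.freshLabels
  | _, boxR _ _ _ _ y _ _ _ π => y :: π.freshLabels

/-- Fresh labels are globally fresh: distinct `boxR` instances have distinct fresh labels. -/
def GloballyFresh {S : Sequent α} (π : CSGLProof S) : Prop :=
  π.freshLabels.Nodup

end CSGLProof

/-! The argument is semantic: the given proof is used only through soundness and is not transformed.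
`CSGLProof.sound` shows that a provable `⊢ x : φ` is valid in all transitive, conversely
well-founded frames. It remains to see that every valid `φ` has an end-active proof.

For this, the Gentzen-style sequent calculus for GL is simulated inside the labeled calculus.
`LeafProvable Γ Δ` says that `Γ ⊢ Δ`, placed at any leaf of any tree and in any context, has an
end-active proof. Local rules and initial sequents at the leaf are end-active as they stand. The
modal rule (`LeafProvable.boxR`) creates a new child `y` of the leaf `x`. Then `x` is a pre-leaf
whose only child is the leaf `y`, so boxed formulae may be propagated from `x` to `y`, and the proof
continues at `y` alone, all older formulae becoming context. The lower bound `N` on fresh labels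
keeps labels of different instances apart.

These simulated rules are complete without cut. A sequent that is not `LeafProvable` is saturated to
a Hintikka pair, and the Hintikka pairs over a finite subformula-closed set form a transitive,
conversely well-founded model in which `φ` fails (`HintikkaPair.truth`), contradicting soundness. -/

/-- Kripke forcing for provability logic. -/
def Forces {α W : Type*} (R : W → W → Prop) (V : W → α → Prop) : W → Formula α → Prop
  | w, .atom p => V w p
  | w, .neg φ => ¬ Forces R V w φ
  | w, .or φ ψ => Forces R V w φ ∨ Forces R V w ψ
  | w, .box φ => ∀ v, R w v → Forces R V v φ

/-! ### Soundness for transitive, conversely well-founded frames. -/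

section Soundness

variable {α W : Type*} {R : W → W → Prop} {V : W → α → Prop}

/-- In a transitive, conversely well-founded frame, a world refuting `□φ` sees a world that
refutes `φ` and forces `□φ`. -/
theorem exists_maximal_refutation (trans : ∀ a b c, R a b → R b c → R a c)
    (wf : WellFounded (flip R)) {w : W} {φ : Formula α} (h : ¬ Forces R V w (.box φ)) :
    ∃ v, R w v ∧ ¬ Forces R V v φ ∧ Forces R V v (.box φ) := by
  simp only [Forces, not_forall] at h
  obtain ⟨u, hu, hφ⟩ := h
  -- Minimal for `flip R` means maximal for `R`: by transitivity, every successor of `m` is again a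
  -- successor of `w`, hence forces `φ`.
  obtain ⟨m, ⟨hm, hmφ⟩, hmin⟩ :=
    wf.has_min {v | R w v ∧ ¬ Forces R V v φ} ⟨u, hu, hφ⟩
  refine ⟨m, hm, hmφ, fun v hv => ?_⟩
  by_contra hc
  exact hmin v ⟨trans _ _ _ hm hv, hc⟩ hv

theorem fst_ne_of_not_mem_labels {S : Sequent α} {y : Label} (h : y ∉ S.labels) :
    (∀ a b, (a, b) ∈ S.rel → a ≠ y ∧ b ≠ y) ∧ (∀ p ∈ S.ant, p.1 ≠ y) ∧ (∀ p ∈ S.suc, p.1 ≠ y) := by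
  simp only [Sequent.labels, relLabels, formulaLabels, Finset.mem_union, Finset.mem_image,
    Multiset.mem_toFinset, Multiset.mem_map, not_or] at h
  obtain ⟨⟨h1, h2⟩, h3, h4⟩ := h
  refine ⟨fun a b hab => ⟨fun e => h1 ⟨_, hab, e⟩, fun e => h2 ⟨_, hab, e⟩⟩,
    fun p hp e => h3 ⟨p, hp, e⟩, fun p hp e => h4 ⟨p, hp, e⟩⟩

/-- Labels are interpreted as worlds, edges as accessibility. Transitivity validates `fourL`. The
diagonal formula `y : □φ` in the premise of `boxR` is justified by sending `y` to a maximal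
refutation of `φ`. -/
theorem CSGLProof.sound (trans : ∀ a b c, R a b → R b c → R a c) (wf : WellFounded (flip R))
    {S : Sequent α} (π : CSGLProof S) (f : Label → W)
    (hrel : ∀ a b, (a, b) ∈ S.rel → R (f a) (f b))
    (hant : ∀ p ∈ S.ant, Forces R V (f p.1) p.2) :
    ∃ p ∈ S.suc, Forces R V (f p.1) p.2 := by
  induction π generalizing f with
  | id1 T Γ Δ x p tree => exact ⟨_, Multiset.mem_cons_self _ _, hant _ (Multiset.mem_cons_self _ _)⟩
  | id2 T Γ Δ x p tree => exact ⟨_, Multiset.mem_cons_self _ _, hant _ (Multiset.mem_cons_self _ _)⟩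
  | negL T Γ Δ x φ tree π ih =>
    simp only [Multiset.mem_cons, forall_eq_or_imp, exists_eq_or_imp] at *
    exact (ih f hrel hant.2).resolve_left hant.1
  | negR T Γ Δ x φ tree π ih =>
    simp only [Multiset.mem_cons, forall_eq_or_imp, exists_eq_or_imp] at *
    by_cases h : Forces R V (f x) φ
    · exact Or.inr (ih f hrel ⟨h, hant⟩)
    · exact Or.inl h
  | orL T Γ Δ x φ ψ tree π₁ π₂ ih₁ ih₂ =>
    simp only [Multiset.mem_cons, forall_eq_or_imp] at *
    rcases hant with ⟨h | h, hant⟩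
    · exact ih₁ f hrel ⟨h, hant⟩
    · exact ih₂ f hrel ⟨h, hant⟩
  | orR T Γ Δ x φ ψ tree π ih =>
    simp only [Multiset.mem_cons, exists_eq_or_imp] at *
    rcases ih f hrel hant with h | h | h
    · exact Or.inl (Or.inl h)
    · exact Or.inl (Or.inr h)
    · exact Or.inr h
  | boxL T Γ Δ x y φ edge tree π ih =>
    simp only [Multiset.mem_cons, forall_eq_or_imp] at *
    exact ih f hrel ⟨hant.1 _ (hrel _ _ edge), hant⟩
  | fourL T Γ Δ x y φ edge tree π ih =>
    simp only [Multiset.mem_cons, forall_eq_or_imp] at *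
    exact ih f hrel ⟨fun v hv => hant.1 _ (trans _ _ _ (hrel _ _ edge) hv), hant⟩
  | boxR T Γ Δ x y φ fresh tree π ih =>
    obtain ⟨hT, hΓ, hΔ⟩ := fst_ne_of_not_mem_labels fresh
    simp only [Multiset.mem_cons, forall_eq_or_imp, exists_eq_or_imp] at *
    by_cases h : Forces R V (f x) (.box φ)
    · exact Or.inl h
    right
    obtain ⟨v, hxv, hvφ, hvb⟩ := exists_maximal_refutation trans wf h
    -- Since `y` is fresh, reinterpreting it as `v` affects nothing in the conclusion.
    have hx : Function.update f y v x = f x := Function.update_of_ne hΔ.1 _ _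
    have hprem := ih (Function.update f y v) ?_ ⟨?_, ?_⟩
    · rcases hprem with h | ⟨p, hp, h⟩
      · rw [Function.update_self] at h
        exact absurd h hvφ
      · rw [Function.update_of_ne (hΔ.2 p hp)] at h
        exact ⟨p, hp, h⟩
    · intro a b hab
      rcases Finset.mem_insert.1 hab with e | hab
      · obtain ⟨rfl, rfl⟩ := Prod.mk.inj e
        rwa [hx, Function.update_self]
      · rw [Function.update_of_ne (hT a b hab).1, Function.update_of_ne (hT a b hab).2]
        exact hrel a b hab
    · rwa [Function.update_self]
    · intro p hp
      rw [Function.update_of_ne (hΓ p hp)]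
      exact hant p hp

end Soundness

/-! ### End-active simulation of the Gentzen-style rules at a leaf. -/

section EndActiveRules

variable {α : Type*}

/-- `S` has an end-active proof whose fresh labels are pairwise distinct and at least `N`. -/
def EndActiveProvable (N : ℕ) (S : Sequent α) : Prop :=
  ∃ π : CSGLProof S, π.EndActive ∧ π.freshLabels.Nodup ∧ ∀ y ∈ π.freshLabels, N ≤ y

/-- `x` is a leaf of the tree `T`, or its only label if `T` is empty. -/
structure IsTreeLeaf (T : Finset (Label × Label)) (x : Label) : Prop where
  tree : IsTree T
  mem : T ≠ ∅ → x ∈ relLabels T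
  leaf : ∀ y, (x, y) ∉ T

/-- The labels of `Γ` occur in `T` or are equal to `x`. -/
def LabelsIn (T : Finset (Label × Label)) (x : Label) (Γ : Multiset (LFormula α)) : Prop :=
  ∀ p ∈ Γ, p.1 = x ∨ p.1 ∈ relLabels T

theorem mem_formulaLabels {Γ : Multiset (LFormula α)} {z : Label} :
    z ∈ formulaLabels Γ ↔ ∃ p ∈ Γ, p.1 = z := by
  simp [formulaLabels]

theorem mem_relLabels {T : Finset (Label × Label)} {z : Label} :
    z ∈ relLabels T ↔ ∃ a b, (a, b) ∈ T ∧ (a = z ∨ b = z) := by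
  simp only [relLabels, Finset.mem_union, Finset.mem_image, Prod.exists]
  constructor
  · rintro (⟨a, b, h, e⟩ | ⟨a, b, h, e⟩)
    · exact ⟨a, b, h, Or.inl e⟩
    · exact ⟨a, b, h, Or.inr e⟩
  · rintro ⟨a, b, h, e | e⟩
    · exact Or.inl ⟨a, b, h, e⟩
    · exact Or.inr ⟨a, b, h, e⟩

theorem IsTreeLeaf.isTreeSequent {T : Finset (Label × Label)} {x : Label} (hT : IsTreeLeaf T x)
    {Γ Δ : Multiset (LFormula α)} (hΓ : LabelsIn T x Γ) (hΔ : LabelsIn T x Δ)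
    (hx : ∃ φ, (x, φ) ∈ Γ ∨ (x, φ) ∈ Δ) : Sequent.IsTreeSequent ⟨T, Γ, Δ⟩ := by
  have hsub : ∀ z ∈ formulaLabels Γ ∪ formulaLabels Δ, z = x ∨ z ∈ relLabels T := by
    intro z hz
    rcases Finset.mem_union.1 hz with h | h <;> obtain ⟨p, hp, rfl⟩ := mem_formulaLabels.1 h
    · exact hΓ p hp
    · exact hΔ p hp
  refine ⟨hT.tree, fun hne z hz => ?_, fun he => ?_⟩
  · rcases hsub z hz with rfl | h
    · exact hT.mem hne
    · exact h
  · refine Finset.card_eq_one.2 ⟨x, Finset.eq_singleton_iff_unique_mem.2 ⟨?_, fun z hz => ?_⟩⟩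
    · obtain ⟨φ, h | h⟩ := hx
      · exact Finset.mem_union_left _ (mem_formulaLabels.2 ⟨_, h, rfl⟩)
      · exact Finset.mem_union_right _ (mem_formulaLabels.2 ⟨_, h, rfl⟩)
    · refine (hsub z hz).resolve_right fun h => ?_
      obtain ⟨a, b, hab, -⟩ := mem_relLabels.1 h
      change T = ∅ at he
      simp [he] at hab

theorem IsTreeLeaf.isLeaf {T : Finset (Label × Label)} {x : Label} (hT : IsTreeLeaf T x)
    {Γ Δ : Multiset (LFormula α)} (hx : ∃ φ, (x, φ) ∈ Γ ∨ (x, φ) ∈ Δ) :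
    Sequent.IsLeaf ⟨T, Γ, Δ⟩ x := by
  refine ⟨Finset.mem_union_right _ ?_, hT.leaf⟩
  obtain ⟨φ, h | h⟩ := hx
  · exact Finset.mem_union_left _ (mem_formulaLabels.2 ⟨_, h, rfl⟩)
  · exact Finset.mem_union_right _ (mem_formulaLabels.2 ⟨_, h, rfl⟩)

theorem IsTreeLeaf.insert {T : Finset (Label × Label)} {x y : Label} (hT : IsTreeLeaf T x)
    (hyx : y ≠ x) (hy : y ∉ relLabels T) : IsTreeLeaf (insert (x, y) T) y := by
  have hyT : ∀ a b, (a, b) ∈ T → a ≠ y ∧ b ≠ y := fun a b h =>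
    ⟨fun e => hy (mem_relLabels.2 ⟨a, b, h, Or.inl e⟩),
      fun e => hy (mem_relLabels.2 ⟨a, b, h, Or.inr e⟩)⟩
  refine ⟨?_, fun _ => mem_relLabels.2 ⟨x, y, Finset.mem_insert_self _ _, Or.inr rfl⟩, ?_⟩
  · have huniq : ∀ r, (∀ a, (a, r) ∉ T) → r ≠ y →
        Relation.ReflTransGen (fun a b => (a, b) ∈ T) r x →
        (∀ z ∈ relLabels T, Relation.ReflTransGen (fun a b => (a, b) ∈ T) r z) →
        (∀ a a' b, (a, b) ∈ T → (a', b) ∈ T → a = a') → IsTree (Insert.insert (x, y) T) := by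
      intro r hr hry hx hreach hun
      have hmono : ∀ z, Relation.ReflTransGen (fun a b => (a, b) ∈ T) r z →
          Relation.ReflTransGen (fun a b => (a, b) ∈ Insert.insert (x, y) T) r z :=
        fun z h => Relation.ReflTransGen.mono (fun a b hab => Finset.mem_insert_of_mem hab) _ _ h
      refine ⟨r, fun a ha => ?_, fun z hz => ?_, fun a a' b h h' => ?_⟩
      · rcases Finset.mem_insert.1 ha with e | h
        · exact hry (Prod.mk.inj e).2
        · exact hr a h
      · have hxy := (hmono x hx).tail (Finset.mem_insert_self (x, y) T)
        obtain ⟨a, b, hab, e⟩ := mem_relLabels.1 hz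
        rcases Finset.mem_insert.1 hab with e' | h
        · obtain ⟨rfl, rfl⟩ := Prod.mk.inj e'
          rcases e with rfl | rfl
          · exact hmono _ hx
          · exact hxy
        · exact hmono z (hreach z (mem_relLabels.2 ⟨a, b, h, e⟩))
      · rcases Finset.mem_insert.1 h with e | h <;> rcases Finset.mem_insert.1 h' with e' | h'
        · rw [(Prod.mk.inj e).1, (Prod.mk.inj e').1]
        · exact absurd (Prod.mk.inj e).2 (hyT _ _ h').2
        · exact absurd (Prod.mk.inj e').2 (hyT _ _ h).2
        · exact hun a a' b h h'
    by_cases hne : T = ∅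
    · subst hne
      exact huniq x (by simp) hyx.symm .refl (by simp [relLabels]) (by simp)
    · obtain ⟨r, hr, hreach, hun⟩ := hT.tree
      have hrx := hreach x (hT.mem hne)
      refine huniq r hr ?_ hrx hreach hun
      -- If the root were the new vertex, the path from it to `x` would be trivial or start with an
      -- edge of `T` at that vertex; both are excluded.
      rintro rfl
      rcases hrx.cases_head with e | ⟨b, hb, -⟩
      · exact hyx e
      · exact (hyT _ _ hb).1 rfl
  · intro z hz
    rcases Finset.mem_insert.1 hz with e | h
    · exact hyx (Prod.mk.inj e).1
    · exact (hyT _ _ h).1 rfl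

theorem LabelsIn.cons {T : Finset (Label × Label)} {x : Label} {Γ : Multiset (LFormula α)}
    (h : LabelsIn T x Γ) (φ : Formula α) : LabelsIn T x ((x, φ) ::ₘ Γ) := by
  intro p hp
  rcases Multiset.mem_cons.1 hp with rfl | hp
  · exact Or.inl rfl
  · exact h p hp

theorem LabelsIn.add_map {T : Finset (Label × Label)} {x : Label} {Γ : Multiset (LFormula α)}
    (h : LabelsIn T x Γ) (Θ : Multiset (Formula α)) :
    LabelsIn T x (Θ.map (Prod.mk x) + Γ) := by
  intro p hp
  rcases Multiset.mem_add.1 hp with hp | hp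
  · obtain ⟨ψ, -, rfl⟩ := Multiset.mem_map.1 hp
    exact Or.inl rfl
  · exact h p hp

/-- The formulae `Γ ⊢ Δ` at a leaf suffice for end-active proofs in every tree and every context. -/
def LeafProvable (Γ Δ : Multiset (Formula α)) : Prop :=
  ∀ (T : Finset (Label × Label)) (x : Label) (Γ₀ Δ₀ : Multiset (LFormula α)) (N : ℕ),
    IsTreeLeaf T x → LabelsIn T x Γ₀ → LabelsIn T x Δ₀ →
    EndActiveProvable N ⟨T, Γ.map (Prod.mk x) + Γ₀, Δ.map (Prod.mk x) + Δ₀⟩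

theorem LeafProvable.atom {Γ Δ : Multiset (Formula α)} {p : α} (h : Formula.atom p ∈ Γ)
    (h' : Formula.atom p ∈ Δ) : LeafProvable Γ Δ := by
  intro T x Γ₀ Δ₀ N hT hΓ hΔ
  obtain ⟨Γ, rfl⟩ := Multiset.exists_cons_of_mem h
  obtain ⟨Δ, rfl⟩ := Multiset.exists_cons_of_mem h'
  simp only [Multiset.map_cons, Multiset.cons_add]
  have hx : ∃ φ, (x, φ) ∈ (x, Formula.atom p) ::ₘ (Γ.map (Prod.mk x) + Γ₀) ∨
      (x, φ) ∈ (x, Formula.atom p) ::ₘ (Δ.map (Prod.mk x) + Δ₀) :=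
    ⟨_, Or.inl (Multiset.mem_cons_self _ _)⟩
  exact ⟨.id1 T _ _ x p (hT.isTreeSequent ((hΓ.add_map Γ).cons _) ((hΔ.add_map Δ).cons _) hx),
    hT.isLeaf hx, by simp [CSGLProof.freshLabels], by simp [CSGLProof.freshLabels]⟩

theorem LeafProvable.box {Γ Δ : Multiset (Formula α)} {φ : Formula α} (h : Formula.box φ ∈ Γ)
    (h' : Formula.box φ ∈ Δ) : LeafProvable Γ Δ := by
  intro T x Γ₀ Δ₀ N hT hΓ hΔ
  obtain ⟨Γ, rfl⟩ := Multiset.exists_cons_of_mem h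
  obtain ⟨Δ, rfl⟩ := Multiset.exists_cons_of_mem h'
  simp only [Multiset.map_cons, Multiset.cons_add]
  have hx : ∃ ψ, (x, ψ) ∈ (x, Formula.box φ) ::ₘ (Γ.map (Prod.mk x) + Γ₀) ∨
      (x, ψ) ∈ (x, Formula.box φ) ::ₘ (Δ.map (Prod.mk x) + Δ₀) :=
    ⟨_, Or.inl (Multiset.mem_cons_self _ _)⟩
  exact ⟨.id2 T _ _ x φ (hT.isTreeSequent ((hΓ.add_map Γ).cons _) ((hΔ.add_map Δ).cons _) hx),
    hT.isLeaf hx, by simp [CSGLProof.freshLabels], by simp [CSGLProof.freshLabels]⟩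

theorem LeafProvable.negL {Γ Δ : Multiset (Formula α)} {φ : Formula α}
    (h : LeafProvable Γ (φ ::ₘ Δ)) : LeafProvable (.neg φ ::ₘ Γ) Δ := by
  intro T x Γ₀ Δ₀ N hT hΓ hΔ
  obtain ⟨π, h₁, h₂, h₃⟩ : EndActiveProvable N
      ⟨T, Γ.map (Prod.mk x) + Γ₀, (x, φ) ::ₘ (Δ.map (Prod.mk x) + Δ₀)⟩ := by
    simpa using h T x Γ₀ Δ₀ N hT hΓ hΔ
  simp only [Multiset.map_cons, Multiset.cons_add]
  have hx : ∃ ψ, (x, ψ) ∈ (x, Formula.neg φ) ::ₘ (Γ.map (Prod.mk x) + Γ₀) ∨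
      (x, ψ) ∈ Δ.map (Prod.mk x) + Δ₀ := ⟨_, Or.inl (Multiset.mem_cons_self _ _)⟩
  exact ⟨.negL T _ _ x φ (hT.isTreeSequent ((hΓ.add_map Γ).cons _) (hΔ.add_map Δ) hx) π,
    ⟨hT.isLeaf hx, h₁⟩, h₂, h₃⟩

theorem LeafProvable.negR {Γ Δ : Multiset (Formula α)} {φ : Formula α}
    (h : LeafProvable (φ ::ₘ Γ) Δ) : LeafProvable Γ (.neg φ ::ₘ Δ) := by
  intro T x Γ₀ Δ₀ N hT hΓ hΔ
  obtain ⟨π, h₁, h₂, h₃⟩ : EndActiveProvable N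
      ⟨T, (x, φ) ::ₘ (Γ.map (Prod.mk x) + Γ₀), Δ.map (Prod.mk x) + Δ₀⟩ := by
    simpa using h T x Γ₀ Δ₀ N hT hΓ hΔ
  simp only [Multiset.map_cons, Multiset.cons_add]
  have hx : ∃ ψ, (x, ψ) ∈ Γ.map (Prod.mk x) + Γ₀ ∨
      (x, ψ) ∈ (x, Formula.neg φ) ::ₘ (Δ.map (Prod.mk x) + Δ₀) :=
    ⟨_, Or.inr (Multiset.mem_cons_self _ _)⟩
  exact ⟨.negR T _ _ x φ (hT.isTreeSequent (hΓ.add_map Γ) ((hΔ.add_map Δ).cons _) hx) π,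
    ⟨hT.isLeaf hx, h₁⟩, h₂, h₃⟩

theorem LeafProvable.orL {Γ Δ : Multiset (Formula α)} {φ ψ : Formula α}
    (h : LeafProvable (φ ::ₘ Γ) Δ) (h' : LeafProvable (ψ ::ₘ Γ) Δ) :
    LeafProvable (.or φ ψ ::ₘ Γ) Δ := by
  intro T x Γ₀ Δ₀ N hT hΓ hΔ
  obtain ⟨π, h₁, h₂, h₃⟩ : EndActiveProvable N
      ⟨T, (x, φ) ::ₘ (Γ.map (Prod.mk x) + Γ₀), Δ.map (Prod.mk x) + Δ₀⟩ := by
    simpa using h T x Γ₀ Δ₀ N hT hΓ hΔ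
  -- The second premise takes its fresh labels from `M` on, hence disjoint from those of the first.
  obtain ⟨M, hM⟩ : ∃ M, ∀ y ∈ π.freshLabels, y < M :=
    ⟨π.freshLabels.sum + 1, fun y hy => Nat.lt_succ_of_le (List.le_sum_of_mem hy)⟩
  obtain ⟨π', h₁', h₂', h₃'⟩ : EndActiveProvable (max N M)
      ⟨T, (x, ψ) ::ₘ (Γ.map (Prod.mk x) + Γ₀), Δ.map (Prod.mk x) + Δ₀⟩ := by
    simpa using h' T x Γ₀ Δ₀ (max N M) hT hΓ hΔ
  simp only [Multiset.map_cons, Multiset.cons_add]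
  have hx : ∃ χ, (x, χ) ∈ (x, Formula.or φ ψ) ::ₘ (Γ.map (Prod.mk x) + Γ₀) ∨
      (x, χ) ∈ Δ.map (Prod.mk x) + Δ₀ := ⟨_, Or.inl (Multiset.mem_cons_self _ _)⟩
  refine ⟨.orL T _ _ x φ ψ (hT.isTreeSequent ((hΓ.add_map Γ).cons _) (hΔ.add_map Δ) hx) π π',
    ⟨hT.isLeaf hx, h₁, h₁'⟩, List.nodup_append.2 ⟨h₂, h₂', fun a ha b hb => ?_⟩,
    fun y hy => (List.mem_append.1 hy).elim (h₃ y) fun hy => ?_⟩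
  · exact ((hM a ha).trans_le ((le_max_right _ _).trans (h₃' b hb))).ne
  · exact (le_max_left _ _).trans (h₃' y hy)

theorem LeafProvable.orR {Γ Δ : Multiset (Formula α)} {φ ψ : Formula α}
    (h : LeafProvable Γ (φ ::ₘ ψ ::ₘ Δ)) : LeafProvable Γ (.or φ ψ ::ₘ Δ) := by
  intro T x Γ₀ Δ₀ N hT hΓ hΔ
  obtain ⟨π, h₁, h₂, h₃⟩ : EndActiveProvable N
      ⟨T, Γ.map (Prod.mk x) + Γ₀, (x, φ) ::ₘ (x, ψ) ::ₘ (Δ.map (Prod.mk x) + Δ₀)⟩ := by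
    simpa using h T x Γ₀ Δ₀ N hT hΓ hΔ
  simp only [Multiset.map_cons, Multiset.cons_add]
  have hx : ∃ χ, (x, χ) ∈ Γ.map (Prod.mk x) + Γ₀ ∨
      (x, χ) ∈ (x, Formula.or φ ψ) ::ₘ (Δ.map (Prod.mk x) + Δ₀) :=
    ⟨_, Or.inr (Multiset.mem_cons_self _ _)⟩
  exact ⟨.orR T _ _ x φ ψ (hT.isTreeSequent (hΓ.add_map Γ) ((hΔ.add_map Δ).cons _) hx) π,
    ⟨hT.isLeaf hx, h₁⟩, h₂, h₃⟩

/-- Boxed formulae at a pre-leaf `x` with the single child `y` may be propagated to `y`. -/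
theorem EndActiveProvable.propagate {T : Finset (Label × Label)} {x y : Label} {N : ℕ}
    (hT : IsTreeLeaf T y) (hxy : (x, y) ∈ T) (huniq : ∀ z, (x, z) ∈ T → z = y)
    {Δ : Multiset (LFormula α)} (hΔ : LabelsIn T y Δ) (hy : ∃ φ, (y, φ) ∈ Δ)
    (Θ : Multiset (Formula α)) : ∀ {Γ : Multiset (LFormula α)}, LabelsIn T y Γ →
    (∀ ψ ∈ Θ, (x, Formula.box ψ) ∈ Γ) →
    EndActiveProvable N ⟨T, (Θ + Θ.map Formula.box).map (Prod.mk y) + Γ, Δ⟩ →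
    EndActiveProvable N ⟨T, Γ, Δ⟩ := by
  induction Θ using Multiset.induction with
  | empty => intro Γ _ _ h; simpa using h
  | cons ψ Θ ih =>
    intro Γ hΓ hΘ h
    have hleaf : ∀ Γ' : Multiset (LFormula α), Sequent.IsLeaf ⟨T, Γ', Δ⟩ y := fun Γ' =>
      hT.isLeaf (hy.imp fun _ => Or.inr)
    have hpre : ∀ Γ' : Multiset (LFormula α), Sequent.IsPreLeaf ⟨T, Γ', Δ⟩ x := fun Γ' =>
      ⟨Finset.mem_union_left _ (mem_relLabels.2 ⟨x, y, hxy, Or.inl rfl⟩),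
        fun z hz => huniq z hz ▸ hleaf Γ'⟩
    -- Read upwards, `fourL` adds `y : □ψ`, then `boxL` adds `y : ψ`; the rest of `Θ` is propagated
    -- above them.
    have key : EndActiveProvable N ⟨T, (y, ψ) ::ₘ (y, .box ψ) ::ₘ Γ, Δ⟩ := by
      refine ih ((hΓ.cons _).cons _) (fun χ hχ => ?_) ?_
      · exact Multiset.mem_cons_of_mem (Multiset.mem_cons_of_mem
          (hΘ χ (Multiset.mem_cons_of_mem hχ)))
      · simpa [Multiset.cons_swap (y, ψ) (y, ψ.box)] using h
    obtain ⟨Γ, rfl⟩ := Multiset.exists_cons_of_mem (hΘ ψ (Multiset.mem_cons_self _ _))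
    have htree : Sequent.IsTreeSequent ⟨T, (x, .box ψ) ::ₘ Γ, Δ⟩ :=
      hT.isTreeSequent hΓ hΔ (hy.imp fun _ => Or.inr)
    have htree' : Sequent.IsTreeSequent ⟨T, (x, .box ψ) ::ₘ (y, .box ψ) ::ₘ Γ, Δ⟩ := by
      rw [Multiset.cons_swap]
      exact hT.isTreeSequent (hΓ.cons _) hΔ (hy.imp fun _ => Or.inr)
    rw [Multiset.cons_swap (y, ψ.box)] at key
    obtain ⟨π, h₁, h₂, h₃⟩ := key
    have key' : EndActiveProvable N ⟨T, (y, .box ψ) ::ₘ (x, .box ψ) ::ₘ Γ, Δ⟩ := by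
      rw [Multiset.cons_swap]
      exact ⟨.boxL T _ _ x y ψ hxy htree' π, ⟨hpre _, hleaf _, h₁⟩, h₂, h₃⟩
    obtain ⟨π', h₁', h₂', h₃'⟩ := key'
    exact ⟨.fourL T _ _ x y ψ hxy htree π', ⟨hpre _, hleaf _, h₁'⟩, h₂', h₃'⟩

/-- The modal rule of the Gentzen-style calculus for provability logic. -/
theorem LeafProvable.boxR {Γ Δ Θ : Multiset (Formula α)} {φ : Formula α}
    (hΘ : ∀ ψ ∈ Θ, Formula.box ψ ∈ Γ) (hφ : Formula.box φ ∈ Δ)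
    (h : LeafProvable (.box φ ::ₘ (Θ + Θ.map Formula.box)) {φ}) : LeafProvable Γ Δ := by
  intro T x Γ₀ Δ₀ N hT hΓ hΔ
  obtain ⟨Δ, rfl⟩ := Multiset.exists_cons_of_mem hφ
  simp only [Multiset.map_cons, Multiset.cons_add]
  set Γ₁ := Γ.map (Prod.mk x) + Γ₀ with hΓ₁
  set Δ₁ := Δ.map (Prod.mk x) + Δ₀
  have hΓ' : LabelsIn T x Γ₁ := hΓ.add_map Γ
  have hΔ' : LabelsIn T x Δ₁ := hΔ.add_map Δ
  obtain ⟨y, hNy, hy⟩ : ∃ y, N ≤ y ∧ y ∉ Sequent.labels ⟨T, Γ₁, (x, .box φ) ::ₘ Δ₁⟩ := by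
    refine ⟨max N ((Sequent.labels ⟨T, Γ₁, (x, .box φ) ::ₘ Δ₁⟩).sup id + 1), le_max_left _ _,
      fun hmem => ?_⟩
    have := Finset.le_sup (f := id) hmem
    simp only [id] at this
    omega
  obtain ⟨hyT, -, hyΔ⟩ := fst_ne_of_not_mem_labels hy
  have hyx : y ≠ x := (hyΔ (x, .box φ) (Multiset.mem_cons_self _ _)).symm
  have hT' : IsTreeLeaf (insert (x, y) T) y :=
    hT.insert hyx fun hm => hy (Finset.mem_union_left _ hm)
  -- The whole old sequent, including what sits at `x`, becomes context for the new leaf `y`.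
  have hlift : ∀ {Ξ : Multiset (LFormula α)}, LabelsIn T x Ξ → LabelsIn (insert (x, y) T) y Ξ := by
    intro Ξ hΞ p hp
    right
    rcases hΞ p hp with e | hm
    · exact mem_relLabels.2 ⟨x, y, Finset.mem_insert_self _ _, Or.inl e.symm⟩
    · obtain ⟨a, b, hab, e⟩ := mem_relLabels.1 hm
      exact mem_relLabels.2 ⟨a, b, Finset.mem_insert_of_mem hab, e⟩
  -- The bound `y + 1` prevents `y` from being chosen again higher up.
  have hprem : EndActiveProvable (y + 1)
      ⟨insert (x, y) T, (y, .box φ) ::ₘ Γ₁, (y, φ) ::ₘ Δ₁⟩ := by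
    refine EndActiveProvable.propagate hT' (Finset.mem_insert_self _ _) (fun z hz => ?_)
      ((hlift hΔ').cons _) ⟨φ, Multiset.mem_cons_self _ _⟩ Θ ((hlift hΓ').cons _)
      (fun ψ hψ => ?_) ?_
    · rcases Finset.mem_insert.1 hz with e | hz
      · exact (Prod.mk.inj e).2
      · exact absurd hz (hT.leaf z)
    · exact Multiset.mem_cons_of_mem
        (Multiset.mem_add.2 (Or.inl (Multiset.mem_map_of_mem _ (hΘ ψ hψ))))
    · simpa using h _ y Γ₁ Δ₁ (y + 1) hT' (hlift hΓ') (hlift hΔ')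
  obtain ⟨π, h₁, h₂, h₃⟩ := hprem
  refine ⟨.boxR T _ _ x y φ hy (hT.isTreeSequent hΓ' (hΔ'.cons _)
    ⟨_, Or.inr (Multiset.mem_cons_self _ _)⟩) π, h₁, List.nodup_cons.2 ⟨fun hm => ?_, h₂⟩,
    fun z hz => ?_⟩
  · have := h₃ y hm
    omega
  · rcases List.mem_cons.1 hz with rfl | hz
    · exact hNy
    · have := h₃ z hz
      omega

end EndActiveRules

/-! ### Saturation of unprovable sequents over a finite subformula-closed set. -/

section Completeness

variable {α : Type*}

/-- Closure under immediate subformulae. -/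
structure SubformulaClosed (C : Set (Formula α)) : Prop where
  neg : ∀ φ, Formula.neg φ ∈ C → φ ∈ C
  or_left : ∀ φ ψ, Formula.or φ ψ ∈ C → φ ∈ C
  or_right : ∀ φ ψ, Formula.or φ ψ ∈ C → ψ ∈ C
  box : ∀ φ, Formula.box φ ∈ C → φ ∈ C

theorem SubformulaClosed.union {C D : Set (Formula α)} (hC : SubformulaClosed C)
    (hD : SubformulaClosed D) : SubformulaClosed (C ∪ D) where
  neg φ := Or.imp (hC.neg φ) (hD.neg φ)
  or_left φ ψ := Or.imp (hC.or_left φ ψ) (hD.or_left φ ψ)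
  or_right φ ψ := Or.imp (hC.or_right φ ψ) (hD.or_right φ ψ)
  box φ := Or.imp (hC.box φ) (hD.box φ)

theorem exists_finite_subformulaClosed (φ : Formula α) :
    ∃ C : Set (Formula α), C.Finite ∧ SubformulaClosed C ∧ φ ∈ C := by
  induction φ with
  | atom p => exact ⟨{.atom p}, Set.finite_singleton _, by constructor <;> simp, rfl⟩
  | neg φ ih =>
    obtain ⟨C, hf, hc, hm⟩ := ih
    refine ⟨insert (.neg φ) C, hf.insert _, ⟨?_, ?_, ?_, ?_⟩, Set.mem_insert _ _⟩
    · rintro ψ (h | h)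
      · cases h; exact Or.inr hm
      · exact Or.inr (hc.neg _ h)
    · rintro ψ χ (h | h)
      · cases h
      · exact Or.inr (hc.or_left _ _ h)
    · rintro ψ χ (h | h)
      · cases h
      · exact Or.inr (hc.or_right _ _ h)
    · rintro ψ (h | h)
      · cases h
      · exact Or.inr (hc.box _ h)
  | or φ ψ ih ih' =>
    obtain ⟨C, hf, hc, hm⟩ := ih
    obtain ⟨D, hf', hd, hm'⟩ := ih'
    have hcd := hc.union hd
    refine ⟨insert (.or φ ψ) (C ∪ D), (hf.union hf').insert _, ⟨?_, ?_, ?_, ?_⟩,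
      Set.mem_insert _ _⟩
    · rintro χ (h | h)
      · cases h
      · exact Or.inr (hcd.neg _ h)
    · rintro χ ξ (h | h)
      · cases h; exact Or.inr (Or.inl hm)
      · exact Or.inr (hcd.or_left _ _ h)
    · rintro χ ξ (h | h)
      · cases h; exact Or.inr (Or.inr hm')
      · exact Or.inr (hcd.or_right _ _ h)
    · rintro χ (h | h)
      · cases h
      · exact Or.inr (hcd.box _ h)
  | box φ ih =>
    obtain ⟨C, hf, hc, hm⟩ := ih
    refine ⟨insert (.box φ) C, hf.insert _, ⟨?_, ?_, ?_, ?_⟩, Set.mem_insert _ _⟩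
    · rintro ψ (h | h)
      · cases h
      · exact Or.inr (hc.neg _ h)
    · rintro ψ χ (h | h)
      · cases h
      · exact Or.inr (hc.or_left _ _ h)
    · rintro ψ χ (h | h)
      · cases h
      · exact Or.inr (hc.or_right _ _ h)
    · rintro ψ (h | h)
      · cases h; exact Or.inr hm
      · exact Or.inr (hc.box _ h)

/-- A saturated pair of sets of formulae from `C` whose atomic and boxed formulae form an
unprovable sequent. -/
structure HintikkaPair (C : Set (Formula α)) where
  left : Set (Formula α)
  right : Set (Formula α)
  left_sub : left ⊆ C
  right_sub : right ⊆ C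
  neg_left : ∀ φ, Formula.neg φ ∈ left → φ ∈ right
  neg_right : ∀ φ, Formula.neg φ ∈ right → φ ∈ left
  or_left : ∀ φ ψ, Formula.or φ ψ ∈ left → φ ∈ left ∨ ψ ∈ left
  or_right : ∀ φ ψ, Formula.or φ ψ ∈ right → φ ∈ right ∧ ψ ∈ right
  ant : Multiset (Formula α)
  suc : Multiset (Formula α)
  unprovable : ¬ LeafProvable ant suc
  atom_left : ∀ p, Formula.atom p ∈ left → Formula.atom p ∈ ant
  atom_right : ∀ p, Formula.atom p ∈ right → Formula.atom p ∈ suc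
  box_left : ∀ φ, Formula.box φ ∈ left → Formula.box φ ∈ ant
  box_right : ∀ φ, Formula.box φ ∈ right → Formula.box φ ∈ suc

/-- Atoms and boxed formulae. -/
def Formula.IsLiteral : Formula α → Prop
  | .atom _ => True
  | .box _ => True
  | _ => False

/-- The number of connectives, counting atoms as well. -/
def Formula.size : Formula α → ℕ
  | .atom _ => 1
  | .neg φ => φ.size + 1
  | .or φ ψ => φ.size + ψ.size + 1
  | .box φ => φ.size + 1

/-- Adding a compound formula on the left of a Hintikka pair. -/
def HintikkaPair.insertLeft {C : Set (Formula α)} (w : HintikkaPair C) {χ : Formula α}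
    (hχ : χ ∈ C) (hneg : ∀ φ, Formula.neg φ = χ → φ ∈ w.right)
    (hor : ∀ φ ψ, Formula.or φ ψ = χ → φ ∈ w.left ∨ ψ ∈ w.left) (hlit : ¬ χ.IsLiteral) :
    HintikkaPair C :=
  { w with
    left := insert χ w.left
    left_sub := Set.insert_subset hχ w.left_sub
    neg_left := fun φ h => h.elim (hneg φ) (w.neg_left φ)
    neg_right := fun φ h => Or.inr (w.neg_right φ h)
    or_left := fun φ ψ h => (h.elim (hor φ ψ) (w.or_left φ ψ)).imp Or.inr Or.inr
    atom_left := fun p h => h.elim (fun e => (hlit (e ▸ trivial)).elim) (w.atom_left p)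
    box_left := fun φ h => h.elim (fun e => (hlit (e ▸ trivial)).elim) (w.box_left φ) }

/-- Adding a compound formula on the right of a Hintikka pair. -/
def HintikkaPair.insertRight {C : Set (Formula α)} (w : HintikkaPair C) {χ : Formula α}
    (hχ : χ ∈ C) (hneg : ∀ φ, Formula.neg φ = χ → φ ∈ w.left)
    (hor : ∀ φ ψ, Formula.or φ ψ = χ → φ ∈ w.right ∧ ψ ∈ w.right) (hlit : ¬ χ.IsLiteral) :
    HintikkaPair C :=
  { w with
    right := insert χ w.right
    right_sub := Set.insert_subset hχ w.right_sub
    neg_left := fun φ h => Or.inr (w.neg_left φ h)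
    neg_right := fun φ h => h.elim (hneg φ) (w.neg_right φ)
    or_right := fun φ ψ h => (h.elim (hor φ ψ) (w.or_right φ ψ)).imp Or.inr Or.inr
    atom_right := fun p h => h.elim (fun e => (hlit (e ▸ trivial)).elim) (w.atom_right p)
    box_right := fun φ h => h.elim (fun e => (hlit (e ▸ trivial)).elim) (w.box_right φ) }

/-- An unprovable sequent extends to a Hintikka pair. -/
theorem exists_hintikkaPair {C : Set (Formula α)} (hC : SubformulaClosed C)
    (Γ Δ : Multiset (Formula α)) (hΓ : ∀ φ ∈ Γ, φ ∈ C) (hΔ : ∀ φ ∈ Δ, φ ∈ C)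
    (h : ¬ LeafProvable Γ Δ) :
    ∃ w : HintikkaPair C, (∀ φ ∈ Γ, φ ∈ w.left) ∧ (∀ φ ∈ Δ, φ ∈ w.right) := by
  -- Each compound formula is replaced by its immediate subformulae, following the rules backwards
  -- from an unprovable conclusion to an unprovable premise. Atoms and boxes are never decomposed,
  -- so the final sequent, kept as `ant` and `suc`, retains all of them.
  induction hn : (Γ.map Formula.size).sum + (Δ.map Formula.size).sum using
    Nat.strong_induction_on generalizing Γ Δ with
  | _ n ih =>
  subst hn
  by_cases hlit : (∀ φ ∈ Γ, φ.IsLiteral) ∧ ∀ φ ∈ Δ, φ.IsLiteral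
  · exact ⟨{
      left := {φ | φ ∈ Γ}
      right := {φ | φ ∈ Δ}
      left_sub := hΓ
      right_sub := hΔ
      neg_left := fun φ hφ => (hlit.1 _ hφ).elim
      neg_right := fun φ hφ => (hlit.2 _ hφ).elim
      or_left := fun φ ψ hφ => (hlit.1 _ hφ).elim
      or_right := fun φ ψ hφ => (hlit.2 _ hφ).elim
      ant := Γ
      suc := Δ
      unprovable := h
      atom_left := fun _ => id
      atom_right := fun _ => id
      box_left := fun _ => id
      box_right := fun _ => id }, fun _ => id, fun _ => id⟩
  rw [not_and_or] at hlit
  push Not at hlit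
  rcases hlit with ⟨χ, hχ, hnl⟩ | ⟨χ, hχ, hnl⟩
  · obtain ⟨Γ, rfl⟩ := Multiset.exists_cons_of_mem hχ
    simp only [Multiset.mem_cons, forall_eq_or_imp] at hΓ
    cases χ with
    | atom p => exact (hnl trivial).elim
    | box φ => exact (hnl trivial).elim
    | neg φ =>
      obtain ⟨w, hl, hr⟩ := ih _ (by simp [Formula.size]; omega) Γ (φ ::ₘ Δ) hΓ.2
        (by simpa using ⟨hC.neg _ hΓ.1, hΔ⟩) (fun h' => h h'.negL) rfl
      simp only [Multiset.mem_cons, forall_eq_or_imp] at hr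
      exact ⟨w.insertLeft hΓ.1 (by rintro _ ⟨⟩; exact hr.1) (by rintro _ _ ⟨⟩) (fun h => h),
        by simpa [HintikkaPair.insertLeft] using fun φ hφ => Or.inr (hl φ hφ), hr.2⟩
    | or φ ψ =>
      rcases not_and_or.1 fun h' : LeafProvable (φ ::ₘ Γ) Δ ∧ LeafProvable (ψ ::ₘ Γ) Δ =>
        h (h'.1.orL h'.2) with h' | h'
      · obtain ⟨w, hl, hr⟩ := ih _ (by simp [Formula.size]) (φ ::ₘ Γ) Δ
          (by simpa using ⟨hC.or_left _ _ hΓ.1, hΓ.2⟩) hΔ h' rfl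
        simp only [Multiset.mem_cons, forall_eq_or_imp] at hl
        exact ⟨w.insertLeft hΓ.1 (by rintro _ ⟨⟩) (by rintro _ _ ⟨⟩; exact Or.inl hl.1)
          (fun h => h), by simpa [HintikkaPair.insertLeft] using fun φ hφ => Or.inr (hl.2 φ hφ), hr⟩
      · obtain ⟨w, hl, hr⟩ := ih _ (by simp [Formula.size]) (ψ ::ₘ Γ) Δ
          (by simpa using ⟨hC.or_right _ _ hΓ.1, hΓ.2⟩) hΔ h' rfl
        simp only [Multiset.mem_cons, forall_eq_or_imp] at hl
        exact ⟨w.insertLeft hΓ.1 (by rintro _ ⟨⟩) (by rintro _ _ ⟨⟩; exact Or.inr hl.1)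
          (fun h => h), by simpa [HintikkaPair.insertLeft] using fun φ hφ => Or.inr (hl.2 φ hφ), hr⟩
  · obtain ⟨Δ, rfl⟩ := Multiset.exists_cons_of_mem hχ
    simp only [Multiset.mem_cons, forall_eq_or_imp] at hΔ
    cases χ with
    | atom p => exact (hnl trivial).elim
    | box φ => exact (hnl trivial).elim
    | neg φ =>
      obtain ⟨w, hl, hr⟩ := ih _ (by simp [Formula.size]; omega) (φ ::ₘ Γ) Δ
        (by simpa using ⟨hC.neg _ hΔ.1, hΓ⟩) hΔ.2 (fun h' => h h'.negR) rfl
      simp only [Multiset.mem_cons, forall_eq_or_imp] at hl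
      exact ⟨w.insertRight hΔ.1 (by rintro _ ⟨⟩; exact hl.1) (by rintro _ _ ⟨⟩) (fun h => h),
        hl.2, by simpa [HintikkaPair.insertRight] using fun φ hφ => Or.inr (hr φ hφ)⟩
    | or φ ψ =>
      obtain ⟨w, hl, hr⟩ := ih _ (by simp [Formula.size]; omega) Γ (φ ::ₘ ψ ::ₘ Δ) hΓ
        (by simpa using ⟨hC.or_left _ _ hΔ.1, hC.or_right _ _ hΔ.1, hΔ.2⟩)
        (fun h' => h h'.orR) rfl
      simp only [Multiset.mem_cons, forall_eq_or_imp] at hr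
      exact ⟨w.insertRight hΔ.1 (by rintro _ ⟨⟩) (by rintro _ _ ⟨⟩; exact ⟨hr.1, hr.2.1⟩)
        (fun h => h), hl,
        by simpa [HintikkaPair.insertRight] using fun φ hφ => Or.inr (hr.2.2 φ hφ)⟩

/-! ### The canonical model of Hintikka pairs. -/

/-- Accessibility between Hintikka pairs. -/
def HintikkaPair.Rel {C : Set (Formula α)} (w v : HintikkaPair C) : Prop :=
  (∀ φ, Formula.box φ ∈ w.left → φ ∈ v.left ∧ Formula.box φ ∈ v.left) ∧
    ∃ φ, Formula.box φ ∈ v.left ∧ Formula.box φ ∉ w.left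

theorem HintikkaPair.Rel.trans {C : Set (Formula α)} (u v w : HintikkaPair C) (h : u.Rel v)
    (h' : v.Rel w) : u.Rel w := by
  obtain ⟨φ, hφ, hφ'⟩ := h'.2
  exact ⟨fun ψ hψ => h'.1 ψ (h.1 ψ hψ).2, φ, hφ, fun hu => hφ' (h.1 φ hu).2⟩

/-- Along `Rel` the boxed formulae on the left strictly grow inside the finite set `C`, so the
number of those still missing decreases. -/
theorem HintikkaPair.Rel.wellFounded {C : Set (Formula α)} (hf : C.Finite) :
    WellFounded (flip (HintikkaPair.Rel (C := C))) := by
  refine Subrelation.wf (r := InvImage (· < ·) fun w : HintikkaPair C =>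
    {φ | φ ∈ C ∧ (∃ ψ, φ = .box ψ) ∧ φ ∉ w.left}.ncard) ?_ (InvImage.wf _ wellFounded_lt)
  intro v w h
  refine Set.ncard_lt_ncard (Set.ssubset_iff_exists.2 ⟨?_, ?_⟩) (hf.subset fun φ h => h.1)
  · rintro _ ⟨hφ, ⟨ψ, rfl⟩, hv⟩
    exact ⟨hφ, ⟨ψ, rfl⟩, fun hw => hv (h.1 ψ hw).2⟩
  · obtain ⟨φ, hv, hw⟩ := h.2
    exact ⟨.box φ, ⟨v.left_sub hv, ⟨φ, rfl⟩, hw⟩, fun hm => hm.2.2 hv⟩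

/-- The modal rule read contrapositively: its premise is unprovable and saturates to the successor.
The diagonal formula `□φ` is the new box demanded by `Rel`; were it already on the left of `w`, the
initial rule for boxes would apply. -/
theorem HintikkaPair.exists_rel {C : Set (Formula α)} (hf : C.Finite) (hC : SubformulaClosed C)
    (w : HintikkaPair C) {φ : Formula α} (hφ : Formula.box φ ∈ w.right) :
    ∃ v, w.Rel v ∧ φ ∈ v.right := by
  have hfin : {ψ | Formula.box ψ ∈ w.left}.Finite :=
    hf.subset fun ψ hψ => hC.box ψ (w.left_sub hψ)
  have hmem : ∀ {ψ}, ψ ∈ hfin.toFinset.val ↔ Formula.box ψ ∈ w.left := by simp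
  have hun : ¬ LeafProvable (.box φ ::ₘ (hfin.toFinset.val + hfin.toFinset.val.map Formula.box)) {φ} :=
    fun h => w.unprovable
      (h.boxR (fun ψ hψ => w.box_left ψ (hmem.1 hψ)) (w.box_right φ hφ))
  have hv := exists_hintikkaPair hC _ _ (fun χ hχ => ?_) (fun χ hχ => ?_) hun
  · obtain ⟨v, hl, hr⟩ := hv
    refine ⟨v, ⟨fun ψ hψ => ⟨hl _ ?_, hl _ ?_⟩, φ, hl _ (Multiset.mem_cons_self _ _), fun h => ?_⟩,
      hr _ (Multiset.mem_singleton_self _)⟩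
    · exact Multiset.mem_cons_of_mem (Multiset.mem_add.2 (Or.inl (hmem.2 hψ)))
    · exact Multiset.mem_cons_of_mem
        (Multiset.mem_add.2 (Or.inr (Multiset.mem_map_of_mem _ (hmem.2 hψ))))
    · exact w.unprovable (.box (w.box_left _ h) (w.box_right _ hφ))
  · rcases Multiset.mem_cons.1 hχ with rfl | hχ
    · exact w.right_sub hφ
    · rcases Multiset.mem_add.1 hχ with hχ | hχ
      · exact hC.box _ (w.left_sub (hmem.1 hχ))
      · obtain ⟨ψ, hψ, rfl⟩ := Multiset.mem_map.1 hχ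
        exact w.left_sub (hmem.1 hψ)
  · rw [Multiset.mem_singleton.1 hχ]
    exact hC.box _ (w.right_sub hφ)

/-- Two implications rather than an equivalence, since a pair need not decide every formula of `C`;
this is what makes cut unnecessary. -/
theorem HintikkaPair.truth {C : Set (Formula α)} (hf : C.Finite) (hC : SubformulaClosed C)
    (φ : Formula α) : ∀ w : HintikkaPair C,
    (φ ∈ w.left → Forces HintikkaPair.Rel (fun w p => Formula.atom p ∈ w.left) w φ) ∧
    (φ ∈ w.right → ¬ Forces HintikkaPair.Rel (fun w p => Formula.atom p ∈ w.left) w φ) := by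
  induction φ with
  | atom p =>
    exact fun w => ⟨id, fun hr hl => w.unprovable (.atom (w.atom_left p hl) (w.atom_right p hr))⟩
  | neg φ ih =>
    exact fun w => ⟨fun h => (ih w).2 (w.neg_left φ h),
      fun h h' => h' ((ih w).1 (w.neg_right φ h))⟩
  | or φ ψ ih ih' =>
    exact fun w => ⟨fun h => (w.or_left φ ψ h).imp (ih w).1 (ih' w).1,
      fun h h' => h'.elim ((ih w).2 (w.or_right φ ψ h).1) ((ih' w).2 (w.or_right φ ψ h).2)⟩
  | box φ ih =>
    refine fun w => ⟨fun h v hv => (ih v).1 (hv.1 φ h).1, fun h h' => ?_⟩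
    obtain ⟨v, hv, hφ⟩ := w.exists_rel hf hC h
    exact (ih v).2 hφ (h' v hv)

end Completeness

/-! ### From soundness and completeness to end-active proofs. -/

theorem mainTheorem2 {α : Type*} (x : Label) (φ : Formula α)
    (π : CSGLProof (Sequent.single x φ)) :
    ∃ π' : CSGLProof (Sequent.single x φ), π'.EndActive ∧ π'.GloballyFresh := by
  by_cases h : LeafProvable 0 {φ}
  · have hT : IsTreeLeaf ∅ x := ⟨⟨x, by simp, by simp [relLabels], by simp⟩, by simp, by simp⟩
    obtain ⟨π', h₁, h₂, -⟩ : EndActiveProvable 0 (Sequent.single x φ) := by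
      simpa [Sequent.single] using h ∅ x 0 0 0 hT (by simp [LabelsIn]) (by simp [LabelsIn])
    exact ⟨π', h₁, h₂⟩
  · exfalso
    obtain ⟨C, hf, hC, hφ⟩ := exists_finite_subformulaClosed φ
    obtain ⟨w, -, hr⟩ := exists_hintikkaPair hC _ _ (by simp) (by simpa using hφ) h
    -- Without relational atoms, any interpretation of labels is admissible, so all are sent to the
    -- refuting world `w`.
    obtain ⟨p, hp, hforce⟩ := π.sound (V := fun w p => Formula.atom p ∈ w.left)
      HintikkaPair.Rel.trans (HintikkaPair.Rel.wellFounded hf) (fun _ => w)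
      (by simp [Sequent.single]) (by simp [Sequent.single])
    obtain rfl := Multiset.mem_singleton.1 hp
    exact (w.truth hf hC φ).2 (hr φ (Multiset.mem_singleton_self φ)) hforce
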